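/- Let $q$ be a prime power, let $\alpha_1,\dots,\alpha_{q-1}$ be the distinct nonzero elements of $\mathbb{F}_q$, and let $v_1,\dots,v_{q+1}\in\mathbb{F}_q^*$. Let $\mathcal{C}\subseteq\mathbb{F}_q^{q+1}$ be the generalized doubly-extended Reed–Solomon (GDRS) code with the $3\times(q+1)$ parity check matrix $$H=\begin{bmatrix}1&\cdots&1&1&0\\ \alpha_1&\cdots&\alpha_{q-1}&0&0\\ \alpha_1^2&\cdots&\alpha_{q-1}^2&0&1\end{bmatrix}\operatorname{diag}(v_1,\dots,v_{q+1}),$$ whose columns are the points of a conic in $\mathrm{PG}(2,q)$; that is, $\mathcal{C}=\{x : Hx^{tr}=0\}$. It is a $[q+1,q-2,4]_q$ code: it has dimension $q-2$ and, for $q\ge 3$, minimum distance $4$ (for $q=2$ it is the zero code). A coset of $\mathcal{C}$ is a set $\mathcal{V}=\{c+v: c\in\mathcal{C}\}$ with $v \in \mathbb{F}_q^{q+1}$; its weight is the smallest Hamming weight of a vector in it. Let $A_w$ be the number of codewords of $\mathcal{C}$ of Hamming weight $w$ and $B_w(\mathcal{V})$ the number of vectors of Hamming weight $w$ in $\mathcal{V}$.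 The covering radius $R$ of $\mathcal{C}$ is the least integer such that every vector of $\mathbb{F}_q^{q+1}$ is at Hamming distance at most $R$ from some codeword. Put $$\Omega_w^{(j)}=(-1)^{w}\binom{q+1-j}{w-j}\binom{w-1-j}{2-j}\qquad(j=0,2).$$ Say that a coset $\mathcal{V}$ has distribution $D(b)$ if $B_0(\mathcal{V})=B_1(\mathcal{V})=0$, $B_2(\mathcal{V})=b$ and, for $w=3,4,\dots,q+1$, $$B_w(\mathcal{V})=A_w-\Omega_w^{(0)}+\Omega_w^{(2)}\,b=A_w-\Omega_w^{(0)}+(-1)^{w}\binom{q-1}{q+1-w}\,b .$$ (i) Let $q$ be odd. Then $R=2$. There are $\tfrac12 q(q-1)^2$ weight $2$ cosets with $B_2=\tfrac12(q+1)$ and $\tfrac12(q^3-q)$ weight $2$ cosets with $B_2=\tfrac12(q-1)$. Every weight $2$ coset has distribution $D\bigl(\tfrac12(q+1)\bigr)$ or $D\bigl(\tfrac12(q-1)\bigr)$. (ii) Let $q$ be even. Then $R=3$. There are $(q-1)(q^2-1)$ weight $2$ cosets, and each of them has distribution $D\bigl(\tfrac12 q\bigr)$. There are $q-1$ weight $3$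 cosets; they are exactly the cosets $\mathcal{V}$ with $Hx^{tr}=(0,a,0)^{tr}$ for all $x\in\mathcal{V}$, for some $a\in\mathbb{F}_q^*$ (the nonzero multiples of the nucleus $(0,1,0)^{tr}$ of the conic). Each weight $3$ coset $\mathcal{V}$ satisfies $B_0(\mathcal{V})=B_1(\mathcal{V})=B_2(\mathcal{V})=0$, $B_3(\mathcal{V})=\binom{q+1}{3}$ and $$B_w(\mathcal{V})=A_w-(-1)^{w}\binom{q+1}{w}\binom{w-1}{2},\qquad w=4,5,\dots,q+1 .$$ -/

import Mathlib

namespace MDSCoset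

/-- The `(d - 1) × (q + 1)` parity check matrix `H_d` of a generalized doubly-extended Reed-Solomon
code: columns `(1, α_j, α_j ^ 2, …, α_j ^ (d - 2))` for the `q - 1` first indices `j`, then
`(1, 0, …, 0)` and `(0, …, 0, 1)`, the `j`-th column being multiplied by `v_j`. -/
def gdrsParityCheck {F : Type*} [Field F] (q d : ℕ) (α : Fin (q - 1) → F) (v : Fin (q + 1) → F) :
    Matrix (Fin (d - 1)) (Fin (q + 1)) F :=
  (Matrix.of fun (i : Fin (d - 1)) (j : Fin (q + 1)) =>
    if h : (j : ℕ) < q - 1 then α ⟨j, h⟩ ^ (i : ℕ)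
    else if (j : ℕ) = q - 1 then (if (i : ℕ) = 0 then 1 else 0)
    else (if (i : ℕ) = d - 2 then 1 else 0)) * Matrix.diagonal v

/-- The linear code with parity check matrix `H`: all `x` with `H xᵗʳ = 0`. -/
def codeOfParityCheck {F : Type*} [Field F] {r n : ℕ} (H : Matrix (Fin r) (Fin n) F) :
    Submodule F (Fin n → F) :=
  LinearMap.ker H.mulVecLin

/-- The set of nonzero Hamming weights of codewords of `C`. -/
def nonzeroWeights {F : Type*} [Field F] [DecidableEq F] {n : ℕ} (C : Submodule F (Fin n → F)) :
    Set ℕ :=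
  {w | ∃ c ∈ C, c ≠ 0 ∧ hammingNorm c = w}

/-- The cosets of `C`: the sets `{c + v | c ∈ C}`. -/
def cosets {F : Type*} [Field F] {n : ℕ} (C : Submodule F (Fin n → F)) : Set (Set (Fin n → F)) :=
  {V | ∃ v : Fin n → F, V = {x | ∃ c ∈ C, x = c + v}}

/-- The number of vectors of Hamming weight `w` in a set of vectors. It is `A_w(C)` for the code
`C` itself, and `B_w(V)` for a coset `V`. -/
noncomputable def weightCount {F : Type*} [Field F] [DecidableEq F] {n : ℕ}
    (V : Set (Fin n → F)) (w : ℕ) : ℕ :=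
  Set.ncard {x | x ∈ V ∧ hammingNorm x = w}

/-- The weight of a coset: the smallest Hamming weight of a vector in it. -/
noncomputable def cosetWeight {F : Type*} [Field F] [DecidableEq F] {n : ℕ}
    (V : Set (Fin n → F)) : ℕ :=
  sInf {w | ∃ x ∈ V, hammingNorm x = w}

/-- The set of the cosets of `C` of weight `W`. -/
def cosetsOfWeight {F : Type*} [Field F] [DecidableEq F] {n : ℕ} (C : Submodule F (Fin n → F))
    (W : ℕ) : Set (Set (Fin n → F)) :=
  {V | V ∈ cosets C ∧ cosetWeight V = W}

/-- The covering radius: the least `R` such that the Hamming balls of radius `R` around the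
codewords cover the whole space. -/
noncomputable def coveringRadius {F : Type*} [Field F] [DecidableEq F] {n : ℕ}
    (C : Submodule F (Fin n → F)) : ℕ :=
  sInf {R | ∀ x : Fin n → F, ∃ c ∈ C, hammingDist x c ≤ R}

/-- `Ω_w^{(j)} = (-1)^{w-d} * binom (n-j) (w-j) * binom (w-1-j) (d-2-j)`, for
`j ≤ min (w - 1) (d - 2)` and `w ≤ n`. The sign is written `(-1)^{w+d}`, as `w < d` may occur. -/
def Omega (n d w j : ℕ) : ℤ :=
  (-1) ^ (w + d) * ((n - j).choose (w - j) : ℤ) * ((w - 1 - j).choose (d - 2 - j) : ℤ)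

/-- The weight distribution of a weight `d - 2` coset `V` with `B_{d-2}(V) = b`, for a code `C` of
length `n` and distance `d`. -/
def HasDistributionDSubTwo {F : Type*} [Field F] [DecidableEq F] {n : ℕ}
    (C : Submodule F (Fin n → F)) (d : ℕ) (V : Set (Fin n → F)) (b : ℕ) : Prop :=
  (∀ w, w < d - 2 → weightCount V w = 0) ∧
  weightCount V (d - 2) = b ∧
  ∀ w, d - 1 ≤ w → w ≤ n →
    (weightCount V w : ℤ) =
      weightCount (C : Set (Fin n → F)) w - Omega n d w 0 + Omega n d w (d - 2) * b ∧
    (weightCount V w : ℤ) =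
      weightCount (C : Set (Fin n → F)) w - Omega n d w 0
        + (-1) ^ (w + d) * ((n + 2 - d).choose (n - w) : ℤ) * b

end MDSCoset

/-!
The cosets of the code are the fibres of the syndrome map `x ↦ H x`, so that everything is a
statement about the points `s` of `F ^ 3` relative to the conic formed by the columns of `H`. Three
facts carry the proof.

* *Weight distributions.* Any three columns of `H` form a basis, hence the number of vectors with
  syndrome `s` and support inside a set `U` of at least three coordinates does not depend on `s`.
  By inclusion-exclusion over the subsets of a support, the weight distribution of a coset without
  vectors of weight `0` and `1` differs from the one of the code by terms that involve only its
  number of vectors of weight two (`weightCount_syndromeFiber_eq`).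
* *Secants.* The vectors of weight two with syndrome `s` correspond to the secants of the conic
  through `s`. For `s` off the conic and `P` on it, the line through `s` and `P` meets it in exactly
  one further point unless the polar form of `s ↦ s₁ ^ 2 - s₀ s₂` vanishes at `(s, P)`. Hence twice
  the number of these vectors is the number of points `P` at which the polar form does not vanish
  (`IsConicMatrix.two_mul_weightCount_two`).
* *Tangents.* The points `P` where the polar form with `s` vanishes are the zeros on the projective
  line of `s₀ t ^ 2 - 2 s₁ t + s₂`, whose discriminant is four times the value of the quadratic form
  at `s`. For odd `q` there are two zeros if this value is a nonzero square and none if it is a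
  nonsquare. For even `q` the polynomial is a square up to a factor and has one zero, unless `s` is
  a multiple of the nucleus `(0, 1, 0)`, where it vanishes identically and `s` is on no secant.

The numbers of cosets then follow by counting the vectors on which the quadratic form is zero, a
nonzero square or a nonsquare.
-/

namespace MDSCoset

open Finset

/-! ### Weight distributions by inclusion-exclusion over supports -/

/-- The support of a vector, as a finset of coordinates. -/
def vecSupport {F : Type*} [Field F] [DecidableEq F] {n : ℕ} (x : Fin n → F) : Finset (Fin n) :=
  {i | x i ≠ 0}

/-- The vectors with syndrome `s`. -/
def syndromeFiber {F : Type*} [Field F] {n : ℕ} (H : Matrix (Fin 3) (Fin n) F) (s : Fin 3 → F) :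
    Set (Fin n → F) :=
  {x | H.mulVec x = s}

/-- The number of vectors with syndrome `s` whose support is contained in `U`. -/
def countSupportedIn {F : Type*} [Field F] [Fintype F] [DecidableEq F] {n : ℕ}
    (H : Matrix (Fin 3) (Fin n) F) (s : Fin 3 → F) (U : Finset (Fin n)) : ℕ :=
  #{x : Fin n → F | H.mulVec x = s ∧ vecSupport x ⊆ U}

/-- The number of vectors with syndrome `s` whose support is equal to `T`. -/
def countSupportEq {F : Type*} [Field F] [Fintype F] [DecidableEq F] {n : ℕ}
    (H : Matrix (Fin 3) (Fin n) F) (s : Fin 3 → F) (T : Finset (Fin n)) : ℕ :=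
  #{x : Fin n → F | H.mulVec x = s ∧ vecSupport x = T}

section

variable {F : Type*} [Field F] [DecidableEq F] {n : ℕ}

lemma card_vecSupport (x : Fin n → F) : #(vecSupport x) = hammingNorm x := rfl

lemma mem_vecSupport {x : Fin n → F} {i : Fin n} : i ∈ vecSupport x ↔ x i ≠ 0 := by
  simp [vecSupport]

lemma vecSupport_subset_iff {x : Fin n → F} {U : Finset (Fin n)} :
    vecSupport x ⊆ U ↔ ∀ i, i ∉ U → x i = 0 := by
  simp only [Finset.subset_iff, mem_vecSupport]
  exact forall_congr' fun i => not_imp_comm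

lemma vecSupport_sub_subset {x y : Fin n → F} {U : Finset (Fin n)}
    (hx : vecSupport x ⊆ U) (hy : vecSupport y ⊆ U) : vecSupport (x - y) ⊆ U := by
  rw [vecSupport_subset_iff] at *
  intro i hi
  simp [hx i hi, hy i hi]

lemma vecSupport_add_subset {x y : Fin n → F} {U : Finset (Fin n)}
    (hx : vecSupport x ⊆ U) (hy : vecSupport y ⊆ U) : vecSupport (x + y) ⊆ U := by
  rw [vecSupport_subset_iff] at *
  intro i hi
  simp [hx i hi, hy i hi]

end

/-- Möbius inversion for the indicator function of `S ⊆ U` on the subsets `U` of `T`. -/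
lemma sum_powerset_neg_one_pow_indicator {ι : Type*} [DecidableEq ι] (S T : Finset ι) :
    ∑ U ∈ T.powerset, (-1 : ℤ) ^ (#T + #U) * (if S ⊆ U then 1 else 0) =
      if S = T then 1 else 0 := by
  by_cases hST : S ⊆ T
  · have key : ∑ U ∈ T.powerset, (-1 : ℤ) ^ (#T + #U) * (if S ⊆ U then 1 else 0) =
        ∑ W ∈ (T \ S).powerset, (-1 : ℤ) ^ #W := by
      simp only [mul_ite, mul_one, mul_zero]
      rw [← sum_filter]
      refine sum_nbij' (fun U => T \ U) (fun W => T \ W) ?_ ?_ ?_ ?_ ?_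
      · intro U hU
        rw [mem_filter, mem_powerset] at hU
        exact mem_powerset.2 (sdiff_subset_sdiff subset_rfl hU.2)
      · intro W hW
        rw [mem_powerset] at hW
        rw [mem_filter, mem_powerset]
        refine ⟨sdiff_subset, fun i hi => mem_sdiff.2 ⟨hST hi, fun hiW => ?_⟩⟩
        exact (mem_sdiff.1 (hW hiW)).2 hi
      · intro U hU
        exact Finset.sdiff_sdiff_eq_self (mem_powerset.1 (mem_filter.1 hU).1)
      · intro W hW
        exact Finset.sdiff_sdiff_eq_self ((mem_powerset.1 hW).trans sdiff_subset)
      · intro U hU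
        have hUT := mem_powerset.1 (mem_filter.1 hU).1
        rw [← card_sdiff_add_card_eq_card hUT, add_assoc, pow_add, ← two_mul, pow_mul]
        simp
    rw [key, sum_powerset_neg_one_pow_card]
    refine if_congr ?_ rfl rfl
    rw [sdiff_eq_empty_iff_subset]
    exact ⟨fun h => hST.antisymm h, fun h => h ▸ subset_rfl⟩
  · rw [if_neg (fun h => hST h.subset)]
    refine sum_eq_zero fun U hU => ?_
    rw [if_neg (fun h => hST (h.trans (mem_powerset.1 hU))), mul_zero]

section

variable {F : Type*} [Field F] [Fintype F] [DecidableEq F] {n : ℕ}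
  {H : Matrix (Fin 3) (Fin n) F}

lemma countSupportEq_eq_sum (s : Fin 3 → F) (T : Finset (Fin n)) :
    (countSupportEq H s T : ℤ) =
      ∑ U ∈ T.powerset, (-1 : ℤ) ^ (#T + #U) * countSupportedIn H s U := by
  have h1 : ∀ U, (countSupportedIn H s U : ℤ) =
      ∑ x : Fin n → F, if H.mulVec x = s then (if vecSupport x ⊆ U then 1 else 0) else 0 := by
    intro U
    rw [countSupportedIn, card_filter]
    push_cast
    simp only [ite_and]
  have h2 : (countSupportEq H s T : ℤ) =
      ∑ x : Fin n → F, if H.mulVec x = s then (if vecSupport x = T then 1 else 0) else 0 := by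
    rw [countSupportEq, card_filter]
    push_cast
    simp only [ite_and]
  simp only [h1, h2, mul_sum]
  rw [sum_comm]
  refine sum_congr rfl fun x _ => ?_
  by_cases h : H.mulVec x = s
  · simp only [if_pos h]
    rw [sum_powerset_neg_one_pow_indicator]
  · simp only [if_neg h, mul_zero, sum_const_zero]

lemma weightCount_syndromeFiber (s : Fin 3 → F) (w : ℕ) :
    weightCount (syndromeFiber H s) w =
      #{x : Fin n → F | H.mulVec x = s ∧ hammingNorm x = w} := by
  rw [weightCount, ← Set.ncard_coe_finset]
  congr 1
  ext x
  simp [syndromeFiber]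

lemma weightCount_eq_sum_countSupportEq (s : Fin 3 → F) (w : ℕ) :
    weightCount (syndromeFiber H s) w =
      ∑ T ∈ powersetCard w (univ : Finset (Fin n)), countSupportEq H s T := by
  rw [weightCount_syndromeFiber, card_eq_sum_card_fiberwise (f := vecSupport)
    (t := powersetCard w univ)]
  · refine sum_congr rfl fun T hT => ?_
    rw [countSupportEq, filter_filter]
    congr 1
    ext x
    simp only [mem_filter, mem_univ, true_and]
    refine ⟨fun h => ⟨h.1.1, h.2⟩, fun h => ⟨⟨h.1, ?_⟩, h.2⟩⟩
    rw [← card_vecSupport, h.2, (mem_powersetCard.1 hT).2]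
  · intro x hx
    simp only [coe_filter, mem_univ, true_and, Set.mem_ofPred_eq] at hx
    simp [mem_powersetCard, card_vecSupport, hx.2]

variable (hmin : ∀ x : Fin n → F, H.mulVec x = 0 → hammingNorm x ≤ 3 → x = 0)

include hmin

omit [Fintype F] in
/-- Any three columns of `H` form a basis of the syndrome space. -/
lemma exists_mulVec_eq_of_three_le_card (s : Fin 3 → F) {U : Finset (Fin n)} (hU : 3 ≤ #U) :
    ∃ x : Fin n → F, H.mulVec x = s ∧ vecSupport x ⊆ U ∧ hammingNorm x ≤ 3 := by
  obtain ⟨T, hTU, hT⟩ := exists_subset_card_eq hU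
  let e := T.orderEmbOfFin hT
  let ext' : (Fin 3 → F) → (Fin n → F) := fun y i => ∑ k, if e k = i then y k else 0
  have hsupp : ∀ y, vecSupport (ext' y) ⊆ T := by
    intro y
    rw [vecSupport_subset_iff]
    intro i hi
    refine sum_eq_zero fun k _ => if_neg ?_
    rintro rfl
    exact hi (T.orderEmbOfFin_mem hT k)
  have hval : ∀ y k, ext' y (e k) = y k := by
    intro y k
    simp [ext', e.injective.eq_iff]
  let L : (Fin 3 → F) →ₗ[F] (Fin 3 → F) :=
    { toFun := fun y => H.mulVec (ext' y)
      map_add' := fun y z => by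
        rw [← Matrix.mulVec_add]
        congr 1
        funext i
        simp only [ext', Pi.add_apply, ← sum_add_distrib]
        refine sum_congr rfl fun k _ => ?_
        split_ifs <;> simp
      map_smul' := fun c y => by
        rw [RingHom.id_apply, ← Matrix.mulVec_smul]
        congr 1
        funext i
        simp only [ext', Pi.smul_apply, smul_eq_mul, mul_sum, mul_ite, mul_zero] }
  have hwt : ∀ y, hammingNorm (ext' y) ≤ 3 := fun y => hT ▸ card_le_card (hsupp y)
  have hinj : Function.Injective L := by
    rw [injective_iff_map_eq_zero]
    intro y hy
    have h0 := hmin _ hy (hwt y)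
    funext k
    rw [← hval y k, h0]
    rfl
  obtain ⟨y, hy⟩ := LinearMap.injective_iff_surjective.1 hinj s
  exact ⟨ext' y, hy, (hsupp y).trans hTU, hwt y⟩

lemma countSupportedIn_eq_of_three_le_card (s : Fin 3 → F) {U : Finset (Fin n)} (hU : 3 ≤ #U) :
    countSupportedIn H s U = countSupportedIn H 0 U := by
  obtain ⟨x₀, hx₀, hsupp, -⟩ := exists_mulVec_eq_of_three_le_card hmin s hU
  refine card_nbij' (fun x => x - x₀) (fun x => x + x₀) ?_ ?_ ?_ ?_
  · intro x hx
    simp only [coe_filter, mem_univ, true_and, Set.mem_ofPred_eq] at hx ⊢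
    exact ⟨by rw [Matrix.mulVec_sub, hx.1, hx₀, sub_self], vecSupport_sub_subset hx.2 hsupp⟩
  · intro x hx
    simp only [coe_filter, mem_univ, true_and, Set.mem_ofPred_eq] at hx ⊢
    exact ⟨by rw [Matrix.mulVec_add, hx.1, hx₀, zero_add], vecSupport_add_subset hx.2 hsupp⟩
  · intro x _
    simp
  · intro x _
    simp

lemma countSupportedIn_zero_of_card_le {U : Finset (Fin n)} (hU : #U ≤ 3) :
    countSupportedIn H 0 U = 1 := by
  rw [countSupportedIn, card_eq_one]
  refine ⟨0, ?_⟩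
  ext x
  simp only [mem_filter, mem_univ, true_and, mem_singleton]
  constructor
  · rintro ⟨h0, hx⟩
    exact hmin x h0 ((card_le_card hx).trans hU)
  · rintro rfl
    exact ⟨Matrix.mulVec_zero H, by simp [vecSupport]⟩

/-- The signed count over a single support `T`: only the subsets `U` of `T` with at most two
elements distinguish the syndrome `s` from the syndrome `0`. -/
lemma countSupportEq_sub (s : Fin 3 → F)
    (hs : ∀ x : Fin n → F, H.mulVec x = s → 2 ≤ hammingNorm x)
    {T : Finset (Fin n)} (hT : 3 ≤ #T) :
    (countSupportEq H s T : ℤ) - countSupportEq H 0 T =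
      (-1) ^ #T * (∑ U ∈ powersetCard 2 T, (countSupportEq H s U : ℤ) - (#T - 1).choose 2) := by
  rw [countSupportEq_eq_sum, countSupportEq_eq_sum, ← sum_sub_distrib, sum_powerset]
  have hsmall : ∀ U : Finset (Fin n), #U ≤ 1 → countSupportedIn H s U = 0 := by
    intro U hU
    rw [countSupportedIn, card_eq_zero, filter_eq_empty_iff]
    rintro x - ⟨hx, hxU⟩
    have h1 := hs x hx
    have h2 := card_le_card hxU
    rw [card_vecSupport] at h2
    lia
  have htwo : ∀ U : Finset (Fin n), #U = 2 →
      countSupportedIn H s U = countSupportEq H s U := by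
    intro U hU
    rw [countSupportedIn, countSupportEq]
    congr 1
    ext x
    simp only [mem_filter, mem_univ, true_and]
    refine and_congr_right fun hx => ⟨fun h => ?_, fun h => h.subset⟩
    refine eq_of_subset_of_card_le h ?_
    rw [hU, card_vecSupport]
    exact hs x hx
  rw [← sum_subset (range_mono (show 3 ≤ #T + 1 by lia))]
  · have hconst : ∀ j < 2, ∑ U ∈ powersetCard j T,
        ((-1 : ℤ) ^ (#T + #U) * countSupportedIn H s U
          - (-1) ^ (#T + #U) * countSupportedIn H 0 U) = -(-1) ^ (#T + j) * (#T).choose j := by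
      intro j hj
      rw [sum_congr rfl (g := fun _ => -(-1 : ℤ) ^ (#T + j))]
      · rw [sum_const, card_powersetCard, nsmul_eq_mul, mul_comm]
      · intro U hU
        rw [mem_powersetCard] at hU
        rw [hsmall U (by lia), countSupportedIn_zero_of_card_le hmin (by lia), hU.2]
        simp
    have h2 : ∑ U ∈ powersetCard 2 T,
        ((-1 : ℤ) ^ (#T + #U) * countSupportedIn H s U
          - (-1) ^ (#T + #U) * countSupportedIn H 0 U) =
        (-1) ^ #T * (∑ U ∈ powersetCard 2 T, (countSupportEq H s U : ℤ) - (#T).choose 2) := by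
      rw [mul_sub, mul_sum]
      rw [sum_congr rfl (g := fun U => (-1 : ℤ) ^ #T * countSupportEq H s U - (-1) ^ #T)]
      · rw [sum_sub_distrib, sum_const, card_powersetCard, nsmul_eq_mul]
        ring
      · intro U hU
        rw [mem_powersetCard] at hU
        rw [htwo U hU.2, countSupportedIn_zero_of_card_le hmin (by lia), hU.2]
        ring
    rw [sum_range_succ, sum_range_succ, sum_range_one, hconst 0 (by lia), hconst 1 (by lia), h2]
    obtain ⟨k, hk⟩ : ∃ k, #T = k + 1 := ⟨#T - 1, by lia⟩
    rw [hk, Nat.choose_succ_succ k 1]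
    simp only [Nat.choose_zero_right, Nat.choose_one_right, Nat.add_sub_cancel]
    push_cast
    ring
  · intro j _ hj
    refine sum_eq_zero fun U hU => ?_
    rw [mem_powersetCard] at hU
    rw [mem_range] at hj
    rw [countSupportedIn_eq_of_three_le_card hmin s (by lia), sub_self]

/-- The weight distribution of a coset without vectors of weight less than two is determined by
its number of vectors of weight two. -/
theorem weightCount_syndromeFiber_eq (s : Fin 3 → F)
    (hs : ∀ x : Fin n → F, H.mulVec x = s → 2 ≤ hammingNorm x) {w : ℕ} (hw : 3 ≤ w) :
    (weightCount (syndromeFiber H s) w : ℤ) =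
      weightCount (syndromeFiber H 0) w - (-1) ^ w * (n.choose w : ℤ) * ((w - 1).choose 2 : ℤ)
        + (-1) ^ w * ((n - 2).choose (w - 2) : ℤ) * weightCount (syndromeFiber H s) 2 := by
  have hsum : ∑ T ∈ powersetCard w (univ : Finset (Fin n)),
      ∑ U ∈ powersetCard 2 T, (countSupportEq H s U : ℤ) =
      (n - 2).choose (w - 2) * weightCount (syndromeFiber H s) 2 := by
    rw [weightCount_eq_sum_countSupportEq]
    push_cast
    rw [mul_sum, sum_comm' (t' := powersetCard 2 univ)
      (s' := fun U => {T ∈ powersetCard w (univ : Finset (Fin n)) | U ⊆ T})]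
    · refine sum_congr rfl fun U hU => ?_
      have hU2 := (mem_powersetCard.1 hU).2
      rw [sum_const, card_filter_powersetCard_subset U univ w (subset_univ _) (by lia), hU2]
      simp
    · intro T U
      simp only [mem_powersetCard, mem_filter]
      have := subset_univ U
      tauto
  have hdiff : (weightCount (syndromeFiber H s) w : ℤ) - weightCount (syndromeFiber H 0) w =
      ∑ T ∈ powersetCard w (univ : Finset (Fin n)),
        (-1) ^ w * (∑ U ∈ powersetCard 2 T, (countSupportEq H s U : ℤ) - (w - 1).choose 2) := by
    rw [weightCount_eq_sum_countSupportEq, weightCount_eq_sum_countSupportEq]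
    push_cast
    rw [← sum_sub_distrib]
    refine sum_congr rfl fun T hT => ?_
    have hTw := (mem_powersetCard.1 hT).2
    rw [countSupportEq_sub hmin s hs (by lia), hTw]
  rw [← mul_sum, sum_sub_distrib, hsum, sum_const, card_powersetCard, card_univ,
    Fintype.card_fin, nsmul_eq_mul] at hdiff
  linear_combination hdiff

end

/-! ### Cosets as fibres of the syndrome map -/

section

variable {F : Type*} [Field F] {n : ℕ} {H : Matrix (Fin 3) (Fin n) F}

lemma coe_codeOfParityCheck :
    (codeOfParityCheck H : Set (Fin n → F)) = syndromeFiber H 0 := by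
  ext x
  simp [codeOfParityCheck, syndromeFiber]

lemma coset_eq_syndromeFiber (v : Fin n → F) :
    {x | ∃ c ∈ codeOfParityCheck H, x = c + v} = syndromeFiber H (H.mulVec v) := by
  ext x
  simp only [codeOfParityCheck, LinearMap.mem_ker, Matrix.mulVecLin_apply, syndromeFiber,
    Set.mem_ofPred_eq]
  constructor
  · rintro ⟨c, hc, rfl⟩
    rw [Matrix.mulVec_add, hc, zero_add]
  · intro hx
    exact ⟨x - v, by rw [Matrix.mulVec_sub, hx, sub_self], by simp⟩

lemma cosets_eq_range (hsurj : Function.Surjective H.mulVec) :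
    cosets (codeOfParityCheck H) = Set.range (syndromeFiber H) := by
  ext V
  simp only [cosets, coset_eq_syndromeFiber, Set.mem_ofPred_eq, Set.mem_range]
  constructor
  · rintro ⟨v, rfl⟩
    exact ⟨_, rfl⟩
  · rintro ⟨s, rfl⟩
    obtain ⟨v, rfl⟩ := hsurj s
    exact ⟨v, rfl⟩

lemma syndromeFiber_injective (hsurj : Function.Surjective H.mulVec) :
    Function.Injective (syndromeFiber H) := by
  intro s t hst
  obtain ⟨v, rfl⟩ := hsurj s
  have hv : v ∈ syndromeFiber H t := hst ▸ rfl
  exact hv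

lemma ncard_setOf_mem_cosets (hsurj : Function.Surjective H.mulVec)
    (P : Set (Fin n → F) → Prop) :
    {V | V ∈ cosets (codeOfParityCheck H) ∧ P V}.ncard = {s | P (syndromeFiber H s)}.ncard := by
  rw [← Set.ncard_image_of_injective _ (syndromeFiber_injective hsurj), cosets_eq_range hsurj]
  congr 1
  ext V
  constructor
  · rintro ⟨⟨s, rfl⟩, hs⟩
    exact ⟨s, hs, rfl⟩
  · rintro ⟨s, hs, rfl⟩
    exact ⟨⟨s, rfl⟩, hs⟩

lemma finrank_codeOfParityCheck (hsurj : Function.Surjective H.mulVec) :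
    Module.finrank F (codeOfParityCheck H) = n - 3 := by
  have h := LinearMap.finrank_range_add_finrank_ker H.mulVecLin
  rw [LinearMap.range_eq_top.2 hsurj, finrank_top] at h
  simp only [Module.finrank_fin_fun] at h
  rw [codeOfParityCheck]
  lia

variable [DecidableEq F]

lemma cosetWeight_le {V : Set (Fin n → F)} {x : Fin n → F} (hx : x ∈ V) :
    cosetWeight V ≤ hammingNorm x :=
  Nat.sInf_le ⟨x, hx, rfl⟩

lemma exists_mem_hammingNorm_eq_cosetWeight {V : Set (Fin n → F)} (hV : V.Nonempty) :
    ∃ x ∈ V, hammingNorm x = cosetWeight V := by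
  obtain ⟨x, hx⟩ := hV
  exact Nat.sInf_mem (s := {w | ∃ x ∈ V, hammingNorm x = w}) ⟨_, x, hx, rfl⟩

lemma cosetWeight_eq {V : Set (Fin n → F)} {x : Fin n → F} {w : ℕ} (hx : x ∈ V)
    (hxw : hammingNorm x ≤ w) (h : ∀ y ∈ V, w ≤ hammingNorm y) : cosetWeight V = w := by
  obtain ⟨y, hy, hyw⟩ := exists_mem_hammingNorm_eq_cosetWeight ⟨x, hx⟩
  exact le_antisymm ((cosetWeight_le hx).trans hxw) (hyw ▸ h y hy)

lemma coveringRadius_eq {R : ℕ} (hle : ∀ s, ∃ x, H.mulVec x = s ∧ hammingNorm x ≤ R)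
    {s₀ : Fin 3 → F} (hge : ∀ x, H.mulVec x = s₀ → R ≤ hammingNorm x) :
    coveringRadius (codeOfParityCheck H) = R := by
  apply le_antisymm
  · refine Nat.sInf_le fun x => ?_
    obtain ⟨y, hy, hyR⟩ := hle (H.mulVec x)
    refine ⟨x - y, ?_, ?_⟩
    · simp [codeOfParityCheck, Matrix.mulVec_sub, hy]
    · rwa [hammingDist_comm, hammingDist_eq_hammingNorm, neg_sub, sub_add_cancel]
  · refine le_csInf ⟨n, fun x => ⟨0, zero_mem _, ?_⟩⟩ ?_
    · simpa using hammingDist_le_card_fintype (x := x) (y := 0)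
    · intro r hr
      obtain ⟨x, hx, -⟩ := hle s₀
      obtain ⟨c, hc, hcr⟩ := hr x
      rw [hammingDist_comm, hammingDist_eq_hammingNorm] at hcr
      refine (hge _ ?_).trans hcr
      rw [codeOfParityCheck, LinearMap.mem_ker, Matrix.mulVecLin_apply] at hc
      rw [Matrix.mulVec_add, Matrix.mulVec_neg, hc, hx, neg_zero, zero_add]

lemma isLeast_nonzeroWeights
    (hmin : ∀ x : Fin n → F, H.mulVec x = 0 → hammingNorm x ≤ 3 → x = 0) (hn : 4 ≤ n) :
    IsLeast (nonzeroWeights (codeOfParityCheck H)) 4 := by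
  have hge : ∀ c ∈ codeOfParityCheck H, c ≠ 0 → 4 ≤ hammingNorm c := by
    intro c hc hc0
    by_contra! h
    exact hc0 (hmin c hc (by lia))
  constructor
  · -- a column of `H` is a combination of three other ones
    let j : Fin n := ⟨0, by lia⟩
    have hcard : 3 ≤ #((univ : Finset (Fin n)).erase j) := by
      rw [card_erase_of_mem (mem_univ j), card_univ, Fintype.card_fin]
      lia
    obtain ⟨x, hx, hsupp, hwt⟩ :=
      exists_mulVec_eq_of_three_le_card hmin (H.mulVec (Pi.single j 1)) hcard
    have hxj : x j = 0 := vecSupport_subset_iff.1 hsupp j (by simp)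
    have hker : x - Pi.single j 1 ∈ codeOfParityCheck H := by
      simp [codeOfParityCheck, Matrix.mulVec_sub, hx]
    have hne : x - Pi.single j 1 ≠ 0 := by
      intro h
      have := congrFun h j
      simp [hxj] at this
    refine ⟨_, hker, hne, le_antisymm ?_ (hge _ hker hne)⟩
    have hsub : vecSupport (x - Pi.single j 1) ⊆ insert j (vecSupport x) := by
      rw [vecSupport_subset_iff]
      intro i hi
      rw [mem_insert, mem_vecSupport, not_or, not_not] at hi
      simp [hi.2, Pi.single_eq_of_ne hi.1]
    have h1 := card_le_card hsub
    have h2 := card_insert_le j (vecSupport x)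
    rw [card_vecSupport] at h1 h2
    lia
  · rintro w ⟨c, hc, hc0, rfl⟩
    exact hge c hc hc0

end

/-! ### The conic and its polar form -/

/-- The quadratic form `s₁ ^ 2 - s₀ s₂`, whose zeros are the multiples of the points of the
conic. -/
def conicForm {F : Type*} [Field F] (s : Fin 3 → F) : F := s 1 ^ 2 - s 0 * s 2

/-- The polar form of `conicForm`, such that
`conicForm (s + t) = conicForm s + conicForm t + conicPolar s t`. -/
def conicPolar {F : Type*} [Field F] (s t : Fin 3 → F) : F :=
  2 * s 1 * t 1 - s 0 * t 2 - s 2 * t 0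

/-- The points of the conic, parametrized by the projective line: `(1, t, t ^ 2)` for `some t` and
`(0, 0, 1)` for the point `none` at infinity. -/
def conicPoint {F : Type*} [Field F] : Option F → Fin 3 → F
  | none => ![0, 0, 1]
  | some t => ![1, t, t ^ 2]

section

variable {F : Type*} [Field F]

lemma conicForm_add (s t : Fin 3 → F) :
    conicForm (s + t) = conicForm s + conicForm t + conicPolar s t := by
  simp only [conicForm, conicPolar, Pi.add_apply]
  ring

lemma conicForm_smul (c : F) (s : Fin 3 → F) : conicForm (c • s) = c ^ 2 * conicForm s := by
  simp only [conicForm, Pi.smul_apply, smul_eq_mul]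
  ring

lemma conicPolar_add_left (s s' t : Fin 3 → F) :
    conicPolar (s + s') t = conicPolar s t + conicPolar s' t := by
  simp only [conicPolar, Pi.add_apply]
  ring

lemma conicPolar_smul_left (c : F) (s t : Fin 3 → F) :
    conicPolar (c • s) t = c * conicPolar s t := by
  simp only [conicPolar, Pi.smul_apply, smul_eq_mul]
  ring

lemma conicPolar_smul_right (c : F) (s t : Fin 3 → F) :
    conicPolar s (c • t) = c * conicPolar s t := by
  simp only [conicPolar, Pi.smul_apply, smul_eq_mul]
  ring

lemma conicPolar_comm (s t : Fin 3 → F) : conicPolar s t = conicPolar t s := by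
  simp only [conicPolar]
  ring

lemma conicForm_conicPoint (p : Option F) : conicForm (conicPoint p) = 0 := by
  cases p <;> simp [conicForm, conicPoint]

lemma conicPolar_conicPoint_self (p : Option F) :
    conicPolar (conicPoint p) (conicPoint p) = 0 := by
  cases p <;> simp [conicPolar, conicPoint]
  ring

lemma conicPoint_ne_zero (p : Option F) : conicPoint p ≠ 0 := by
  intro h
  cases p with
  | none => simpa [conicPoint] using congrFun h 2
  | some t => simpa [conicPoint] using congrFun h 0

lemma conicPolar_conicPoint_ne_zero {p p' : Option F} (h : p ≠ p') :
    conicPolar (conicPoint p) (conicPoint p') ≠ 0 := by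
  cases p with
  | none =>
    cases p' with
    | none => exact absurd rfl h
    | some t => simp [conicPolar, conicPoint]
  | some t =>
    cases p' with
    | none => simp [conicPolar, conicPoint]
    | some u =>
      have htu : t - u ≠ 0 := sub_ne_zero.2 fun e => h (congrArg some e)
      have : conicPolar (conicPoint (some t)) (conicPoint (some u)) = -(t - u) ^ 2 := by
        simp [conicPolar, conicPoint]
        ring
      rw [this]
      exact neg_ne_zero.2 (pow_ne_zero 2 htu)

lemma exists_eq_smul_conicPoint {s : Fin 3 → F} (hs : conicForm s = 0) :
    ∃ (c : F) (p : Option F), s = c • conicPoint p := by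
  rw [conicForm, sub_eq_zero] at hs
  by_cases h0 : s 0 = 0
  · have h1 : s 1 = 0 := by simpa [h0] using hs
    refine ⟨s 2, none, ?_⟩
    funext i
    fin_cases i <;> simp [conicPoint, h0, h1]
  · refine ⟨s 0, some (s 1 / s 0), ?_⟩
    funext i
    fin_cases i
    · simp [conicPoint]
    · simp [conicPoint]
      field_simp
    · simp [conicPoint]
      field_simp
      linear_combination -hs

end

/-! ### Parity check matrices whose columns are the points of the conic -/

/-- The columns of `H` are the points of the conic, each occurring once up to the nonzero
multiplier `v j`; `e` indexes the columns by the projective line. -/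
structure IsConicMatrix {F : Type*} [Field F] {n : ℕ} (H : Matrix (Fin 3) (Fin n) F)
    (e : Fin n ≃ Option F) (v : Fin n → F) : Prop where
  ne_zero : ∀ j, v j ≠ 0
  col : ∀ i j, H i j = v j * conicPoint (e j) i

namespace IsConicMatrix

variable {F : Type*} [Field F] [DecidableEq F] {n : ℕ} {H : Matrix (Fin 3) (Fin n) F}
  {e : Fin n ≃ Option F} {v : Fin n → F} (hH : IsConicMatrix H e v)

include hH

omit [DecidableEq F] in
lemma mulVec_eq_sum (x : Fin n → F) :
    H.mulVec x = ∑ j, (x j * v j) • conicPoint (e j) := by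
  funext i
  simp only [Matrix.mulVec, dotProduct, hH.col, Finset.sum_apply, Pi.smul_apply, smul_eq_mul]
  exact sum_congr rfl fun j _ => by ring

omit [DecidableEq F] in
lemma mulVec_single (j : Fin n) (c : F) :
    H.mulVec (Pi.single j c) = (c * v j) • conicPoint (e j) := by
  rw [hH.mulVec_eq_sum, sum_eq_single j]
  · simp
  · intro k _ hk
    simp [hk]
  · simp

lemma mulVec_eq_sum_of_subset {x : Fin n → F} {U : Finset (Fin n)} (hx : vecSupport x ⊆ U) :
    H.mulVec x = ∑ j ∈ U, (x j * v j) • conicPoint (e j) := by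
  rw [hH.mulVec_eq_sum]
  refine (sum_subset (subset_univ U) fun j _ hj => ?_).symm
  rw [vecSupport_subset_iff.1 hx j hj, zero_mul, zero_smul]

/-- No three points of the conic are collinear. -/
lemma eq_zero_of_mulVec_eq_zero (hn : 3 ≤ n) {x : Fin n → F} (hx : H.mulVec x = 0)
    (hwt : hammingNorm x ≤ 3) : x = 0 := by
  obtain ⟨U, hU, hUc⟩ := exists_superset_card_eq (s := vecSupport x) (n := 3)
    (by rwa [card_vecSupport]) (by simpa using hn)
  obtain ⟨i, j, k, hij, hik, hjk, rfl⟩ := card_eq_three.1 hUc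
  rw [hH.mulVec_eq_sum_of_subset hU, sum_insert (by simp [hij, hik]),
    sum_insert (by simp [hjk]), sum_singleton] at hx
  -- `a • P + b • Q` lies on the conic only if `a * b = 0`
  have key : ∀ {a b c : F} {p p' p'' : Option F}, p ≠ p' →
      a • conicPoint p + (b • conicPoint p' + c • conicPoint p'') = 0 → a * b = 0 := by
    intro a b c p p' p'' hp h
    have h1 : a • conicPoint p + b • conicPoint p' = (-c) • conicPoint p'' := by
      rw [neg_smul, eq_neg_iff_add_eq_zero, add_assoc, h]
    have h2 := congrArg conicForm h1
    rw [conicForm_add, conicForm_smul, conicForm_smul, conicForm_smul, conicForm_conicPoint,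
      conicForm_conicPoint, conicForm_conicPoint, conicPolar_smul_left,
      conicPolar_smul_right] at h2
    have h3 : a * b * conicPolar (conicPoint p) (conicPoint p') = 0 := by
      linear_combination h2
    exact (mul_eq_zero.1 h3).resolve_right (conicPolar_conicPoint_ne_zero hp)
  have hab := key (e.injective.ne hij) hx
  have hac := key (c := x j * v j) (p'' := e j) (e.injective.ne hik) (by rw [← hx]; abel)
  have hbc := key (c := x i * v i) (p'' := e i) (e.injective.ne hjk) (by rw [← hx]; abel)
  have hzero : ∀ l, x l * v l = 0 → x l = 0 := fun l h =>
    (mul_eq_zero.1 h).resolve_right (hH.ne_zero l)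
  have hlast : x i * v i = 0 ∧ x j * v j = 0 ∧ x k * v k = 0 := by
    have hpt : ∀ {a : F} {p : Option F}, a • conicPoint p = 0 → a = 0 := fun h =>
      (smul_eq_zero.1 h).resolve_right (conicPoint_ne_zero _)
    rcases mul_eq_zero.1 hab with ha | hb
    · rcases mul_eq_zero.1 hbc with hb | hc
      · rw [ha, hb, zero_smul, zero_smul, zero_add, zero_add] at hx
        exact ⟨ha, hb, hpt hx⟩
      · rw [ha, hc, zero_smul, zero_smul, zero_add, add_zero] at hx
        exact ⟨ha, hpt hx, hc⟩
    · rcases mul_eq_zero.1 hac with ha | hc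
      · rw [ha, hb, zero_smul, zero_smul, zero_add, zero_add] at hx
        exact ⟨ha, hb, hpt hx⟩
      · rw [hb, hc, zero_smul, zero_smul, add_zero, add_zero] at hx
        exact ⟨hpt hx, hb, hc⟩
  funext l
  by_cases hl : l ∈ ({i, j, k} : Finset (Fin n))
  · simp only [mem_insert, mem_singleton] at hl
    rcases hl with rfl | rfl | rfl
    · exact hzero _ hlast.1
    · exact hzero _ hlast.2.1
    · exact hzero _ hlast.2.2
  · exact vecSupport_subset_iff.1 hU l hl

lemma exists_hammingNorm_le_one {s : Fin 3 → F} (hs : conicForm s = 0) :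
    ∃ x, H.mulVec x = s ∧ hammingNorm x ≤ 1 := by
  obtain ⟨c, p, rfl⟩ := exists_eq_smul_conicPoint hs
  refine ⟨Pi.single (e.symm p) (c / v (e.symm p)), ?_, ?_⟩
  · rw [hH.mulVec_single, div_mul_cancel₀ _ (hH.ne_zero _), Equiv.apply_symm_apply]
  · have : vecSupport (Pi.single (e.symm p) (c / v (e.symm p)) : Fin n → F) ⊆ {e.symm p} := by
      rw [vecSupport_subset_iff]
      intro i hi
      rw [mem_singleton] at hi
      exact Pi.single_eq_of_ne hi _
    exact card_le_card this

lemma two_le_hammingNorm {s : Fin 3 → F} (hs : conicForm s ≠ 0) {x : Fin n → F}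
    (hx : H.mulVec x = s) : 2 ≤ hammingNorm x := by
  by_contra! h
  apply hs
  have h1 : #(vecSupport x) ≤ 1 := by
    rw [card_vecSupport]
    lia
  by_cases h0 : vecSupport x = ∅
  · rw [← hx, hH.mulVec_eq_sum_of_subset h0.subset]
    simp [conicForm]
  · obtain ⟨i, hi⟩ := nonempty_iff_ne_empty.2 h0
    have hsub : vecSupport x ⊆ {i} := fun j hj => by
      rw [mem_singleton]
      exact card_le_one.1 h1 j hj i hi
    rw [← hx, hH.mulVec_eq_sum_of_subset hsub, sum_singleton, conicForm_smul,
      conicForm_conicPoint, mul_zero]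

/-- The coefficient at a point `P` in an expression of `s` as a combination of `P` and a second
point of the conic is `conicForm s / conicPolar s P`. -/
lemma coeff_mul_conicPolar {s : Fin 3 → F} {x : Fin n → F} (hx : H.mulVec x = s)
    (hwt : hammingNorm x = 2) {i : Fin n} (hi : x i ≠ 0) :
    x i * v i * conicPolar s (conicPoint (e i)) = conicForm s := by
  obtain ⟨j, hj⟩ : ∃ j, (vecSupport x).erase i = {j} := by
    rw [← card_eq_one, card_erase_of_mem (mem_vecSupport.2 hi), card_vecSupport, hwt]
  have hji : j ≠ i := fun h => by
    have : j ∈ (vecSupport x).erase i := hj ▸ mem_singleton_self j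
    exact (mem_erase.1 this).1 h
  have hsup : vecSupport x = {i, j} := by
    rw [← insert_erase (mem_vecSupport.2 hi), hj]
  rw [← hx, hH.mulVec_eq_sum_of_subset hsup.subset, sum_pair hji.symm]
  simp only [conicForm_add, conicForm_smul, conicForm_conicPoint, conicPolar_add_left,
    conicPolar_smul_left, conicPolar_smul_right, conicPolar_conicPoint_self]
  rw [conicPolar_comm (conicPoint (e j))]
  ring

/-- The line through `s` and a point `P` of the conic meets the conic in a second point, unless it
is a tangent. -/
lemma exists_unique_secant (hn : 3 ≤ n) {s : Fin 3 → F} (hs : conicForm s ≠ 0) {i : Fin n}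
    (hi : conicPolar s (conicPoint (e i)) ≠ 0) :
    ∃! x, (H.mulVec x = s ∧ hammingNorm x = 2) ∧ x i ≠ 0 := by
  set b := conicPolar s (conicPoint (e i)) with hb
  set l := conicForm s / b with hl
  have hform : conicForm (s + (-l) • conicPoint (e i)) = 0 := by
    rw [conicForm_add, conicForm_smul, conicForm_conicPoint, conicPolar_smul_right, ← hb, hl]
    field_simp
    ring
  obtain ⟨c, p, hp⟩ := exists_eq_smul_conicPoint hform
  set j := e.symm p with hj
  set x : Fin n → F := Pi.single i (l / v i) + Pi.single j (c / v j) with hxdef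
  have hx : H.mulVec x = s := by
    rw [hxdef, Matrix.mulVec_add, hH.mulVec_single, hH.mulVec_single,
      div_mul_cancel₀ _ (hH.ne_zero _), div_mul_cancel₀ _ (hH.ne_zero _), hj,
      Equiv.apply_symm_apply, ← hp, neg_smul]
    abel
  have hsub : vecSupport x ⊆ {i, j} := by
    rw [vecSupport_subset_iff]
    intro k hk
    simp only [mem_insert, mem_singleton, not_or] at hk
    simp [hxdef, hk.1, hk.2]
  have h2 := hH.two_le_hammingNorm hs hx
  have hxi : x i ≠ 0 := by
    intro h0
    have hsub' : vecSupport x ⊆ {j} := by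
      rw [vecSupport_subset_iff] at hsub ⊢
      intro k hk
      by_cases hki : k = i
      · rw [hki, h0]
      · exact hsub k (by simpa [hki] using hk)
    have := card_le_card hsub'
    rw [card_vecSupport, card_singleton] at this
    lia
  have hwt : hammingNorm x = 2 :=
    le_antisymm ((card_le_card hsub).trans card_le_two) h2
  refine ⟨x, ⟨⟨hx, hwt⟩, hxi⟩, ?_⟩
  rintro y ⟨⟨hy, hyw⟩, hyi⟩
  -- `x` and `y` agree at `i`, so that `y - x` has weight at most two
  have hyx : y i = x i := by
    have h := (hH.coeff_mul_conicPolar hy hyw hyi).trans (hH.coeff_mul_conicPolar hx hwt hxi).symm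
    exact mul_right_cancel₀ (hH.ne_zero i) (mul_right_cancel₀ hi h)
  refine sub_eq_zero.1 (hH.eq_zero_of_mulVec_eq_zero hn ?_ ?_)
  · rw [Matrix.mulVec_sub, hx, hy, sub_self]
  · have hsub : vecSupport (y - x) ⊆ (vecSupport y).erase i ∪ (vecSupport x).erase i := by
      rw [vecSupport_subset_iff]
      intro k hk
      by_cases hki : k = i
      · rw [hki, Pi.sub_apply, hyx, sub_self]
      · simp only [mem_union, mem_erase, mem_vecSupport, not_or, not_and, not_not] at hk
        rw [Pi.sub_apply, hk.1 hki, hk.2 hki, sub_self]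
    have h1 := (card_le_card hsub).trans (card_union_le _ _)
    rw [card_erase_of_mem (mem_vecSupport.2 hyi), card_erase_of_mem (mem_vecSupport.2 hxi)] at h1
    simp only [card_vecSupport] at h1
    lia

/-- Each vector of weight two with syndrome `s` gives a secant through `s`, which meets the conic
in two points `P` with `conicPolar s P ≠ 0`. -/
theorem two_mul_weightCount_two [Fintype F] (hn : 3 ≤ n) {s : Fin 3 → F}
    (hs : conicForm s ≠ 0) :
    2 * weightCount (syndromeFiber H s) 2 =
      #{p : Option F | conicPolar s (conicPoint p) ≠ 0} := by
  set A : Finset (Fin n → F) := {x | H.mulVec x = s ∧ hammingNorm x = 2} with hA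
  have hdc := sum_card_bipartiteAbove_eq_sum_card_bipartiteBelow (s := A)
    (t := (univ : Finset (Fin n))) (fun x i => x i ≠ 0)
  have hl : ∑ x ∈ A, #(bipartiteAbove (fun (x : Fin n → F) i => x i ≠ 0) univ x) = #A * 2 := by
    rw [sum_const_nat]
    intro x hx
    exact (mem_filter.1 hx).2.2
  have hr : ∑ i : Fin n, #(bipartiteBelow (fun (x : Fin n → F) i => x i ≠ 0) A i) =
      #{i : Fin n | conicPolar s (conicPoint (e i)) ≠ 0} := by
    rw [card_filter]
    refine sum_congr rfl fun i _ => ?_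
    split_ifs with h
    · obtain ⟨x, hx, huniq⟩ := hH.exists_unique_secant hn hs h
      rw [card_eq_one]
      refine ⟨x, ?_⟩
      ext y
      simp only [bipartiteBelow, hA, mem_filter, mem_univ, true_and, mem_singleton]
      exact ⟨huniq y, fun hy => hy ▸ hx⟩
    · rw [card_eq_zero]
      ext y
      simp only [bipartiteBelow, hA, mem_filter, mem_univ, true_and, notMem_empty, iff_false]
      rintro ⟨⟨hy, hyw⟩, hyi⟩
      have := hH.coeff_mul_conicPolar hy hyw hyi
      rw [not_not.1 h, mul_zero] at this
      exact hs this.symm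
  rw [hl, hr] at hdc
  rw [weightCount_syndromeFiber, mul_comm, hdc]
  refine card_bij (fun i _ => e i) ?_ ?_ ?_
  · intro i hi
    simpa using hi
  · intro i _ j _ h
    exact e.injective h
  · intro p hp
    exact ⟨e.symm p, by simpa using hp, by simp⟩

end IsConicMatrix

/-! ### Tangents through a point off the conic -/

section

variable {F : Type*} [Field F]

lemma conicPolar_none (s : Fin 3 → F) : conicPolar s (conicPoint none) = -s 0 := by
  simp [conicPolar, conicPoint]

lemma conicPolar_some (s : Fin 3 → F) (t : F) :
    conicPolar s (conicPoint (some t)) = 2 * s 1 * t - s 0 * t ^ 2 - s 2 := by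
  simp [conicPolar, conicPoint]

lemma mul_conicPolar_some (s : Fin 3 → F) (t : F) :
    s 0 * conicPolar s (conicPoint (some t)) = conicForm s - (s 0 * t - s 1) ^ 2 := by
  rw [conicPolar_some, conicForm]
  ring

variable [Fintype F] [DecidableEq F]

lemma card_conicPolar_ne_zero (s : Fin 3 → F) :
    #{p : Option F | conicPolar s (conicPoint p) ≠ 0} =
      Fintype.card F + 1 - #{p : Option F | conicPolar s (conicPoint p) = 0} := by
  have h := card_filter_add_card_filter_not (s := (univ : Finset (Option F)))
    (fun p => conicPolar s (conicPoint p) = 0)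
  rw [card_univ, Fintype.card_option] at h
  simp only [ne_eq]
  lia

/-- In odd characteristic a point `s` lies on two tangents if `conicForm s` is a nonzero square. -/
lemma card_conicPolar_eq_zero_of_isSquare (h2 : (2 : F) ≠ 0) {s : Fin 3 → F}
    (hs : conicForm s ≠ 0) (hsq : IsSquare (conicForm s)) :
    #{p : Option F | conicPolar s (conicPoint p) = 0} = 2 := by
  rw [card_eq_two]
  by_cases h0 : s 0 = 0
  · have h1 : s 1 ≠ 0 := by
      intro h1
      simp [conicForm, h0, h1] at hs
    refine ⟨none, some (s 2 / (2 * s 1)), by simp, ?_⟩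
    ext p
    simp only [mem_filter, mem_univ, true_and, mem_insert, mem_singleton]
    cases p with
    | none => simp [conicPolar_none, h0]
    | some t =>
      have h21 : 2 * s 1 ≠ 0 := mul_ne_zero h2 h1
      rw [conicPolar_some, h0, zero_mul, sub_zero, sub_eq_zero]
      simp [eq_div_iff h21, mul_comm]
  · obtain ⟨r, hr⟩ := hsq
    have hr0 : r ≠ 0 := by
      rintro rfl
      exact hs (by simpa using hr)
    refine ⟨some ((s 1 + r) / s 0), some ((s 1 - r) / s 0), ?_, ?_⟩
    · intro h
      have h' := (div_left_inj' h0).1 (Option.some_injective _ h)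
      exact mul_ne_zero h2 hr0 (by linear_combination h')
    · ext p
      simp only [mem_filter, mem_univ, true_and, mem_insert, mem_singleton]
      cases p with
      | none => simp [conicPolar_none, h0]
      | some t =>
        rw [← mul_right_inj' h0, mul_conicPolar_some, mul_zero, sub_eq_zero, hr, ← sq, eq_comm,
          sq_eq_sq_iff_eq_or_eq_neg, Option.some_inj, Option.some_inj, eq_div_iff h0,
          eq_div_iff h0]
        refine or_congr ?_ ?_ <;> constructor <;> intro h <;> linear_combination h

/-- In odd characteristic a point `s` lies on no tangent if `conicForm s` is a nonsquare. -/
lemma card_conicPolar_eq_zero_of_not_isSquare {s : Fin 3 → F} (hsq : ¬IsSquare (conicForm s)) :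
    #{p : Option F | conicPolar s (conicPoint p) = 0} = 0 := by
  have h0 : s 0 ≠ 0 := by
    intro h0
    exact hsq ⟨s 1, by rw [conicForm, h0]; ring⟩
  rw [card_eq_zero, filter_eq_empty_iff]
  rintro (_ | t) -
  · simpa [conicPolar_none] using h0
  · intro h
    have h' := mul_conicPolar_some s t
    rw [h, mul_zero, eq_comm, sub_eq_zero] at h'
    exact hsq ⟨_, h'.trans (sq _)⟩

/-- In characteristic two the points other than the nucleus lie on one tangent. -/
lemma card_conicPolar_eq_zero_of_charP_two [CharP F 2] {s : Fin 3 → F}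
    (hs : ¬(s 0 = 0 ∧ s 2 = 0)) :
    #{p : Option F | conicPolar s (conicPoint p) = 0} = 1 := by
  have h2 : (2 : F) = 0 := CharTwo.two_eq_zero
  rw [card_eq_one]
  by_cases h0 : s 0 = 0
  · have h2' : s 2 ≠ 0 := fun h => hs ⟨h0, h⟩
    refine ⟨none, ?_⟩
    ext p
    cases p <;> simp [conicPolar_none, conicPolar_some, h0, h2, h2']
  · obtain ⟨r, hr⟩ := (FiniteField.isSquare_of_char_two (ringChar.eq F 2) (s 2 / s 0) :
      IsSquare (s 2 / s 0))
    refine ⟨some r, ?_⟩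
    ext p
    simp only [mem_filter, mem_univ, true_and, mem_singleton]
    cases p with
    | none => simp [conicPolar_none, h0]
    | some t =>
      rw [div_eq_iff h0] at hr
      have : conicPolar s (conicPoint (some t)) = -(s 0 * (t + r) ^ 2) := by
        rw [conicPolar_some, hr]
        linear_combination (s 1 * t + s 0 * t * r) * h2
      rw [this, neg_eq_zero, mul_eq_zero, or_iff_right h0, sq_eq_zero_iff, CharTwo.add_eq_zero,
        Option.some_inj]

/-- In characteristic two every tangent passes through the nucleus. -/
lemma card_conicPolar_ne_zero_of_nucleus [CharP F 2] {s : Fin 3 → F}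
    (hs : s 0 = 0 ∧ s 2 = 0) :
    #{p : Option F | conicPolar s (conicPoint p) ≠ 0} = 0 := by
  have h2 : (2 : F) = 0 := CharTwo.two_eq_zero
  rw [card_eq_zero, filter_eq_empty_iff]
  rintro (_ | t) - <;> simp [conicPolar_none, conicPolar_some, hs.1, hs.2, h2]

/-! ### Counting points by the value of the quadratic form -/

lemma card_conicForm_eq_zero : #{s : Fin 3 → F | conicForm s = 0} = Fintype.card F ^ 2 := by
  have : Fintype.card F ^ 2 = #(univ : Finset (F × F)) := by
    rw [card_univ, Fintype.card_prod, sq]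
  rw [this]
  refine card_nbij' (fun s => if s 0 = 0 then (0, s 2) else (s 0, s 1))
    (fun a => if a.1 = 0 then ![0, 0, a.2] else ![a.1, a.2, a.2 ^ 2 / a.1]) ?_ ?_ ?_ ?_
  · intro s _
    simp
  · rintro ⟨x, y⟩ -
    simp only [coe_filter, mem_univ, true_and, Set.mem_ofPred_eq]
    split_ifs with h
    · simp [conicForm]
    · simp [conicForm]
      field_simp
      ring
  · intro s hs
    simp only [coe_filter, mem_univ, true_and, Set.mem_ofPred_eq, conicForm, sub_eq_zero] at hs
    by_cases h : s 0 = 0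
    · have h1 : s 1 = 0 := by simpa [h] using hs
      funext i
      fin_cases i <;> simp [h, h1]
    · funext i
      fin_cases i <;> simp [h, hs]
  · rintro ⟨x, y⟩ -
    by_cases h : x = 0 <;> simp [h]

lemma card_conicForm_ne_zero :
    #{s : Fin 3 → F | conicForm s ≠ 0} = Fintype.card F ^ 3 - Fintype.card F ^ 2 := by
  have h := card_filter_add_card_filter_not (s := (univ : Finset (Fin 3 → F)))
    (fun s => conicForm s = 0)
  rw [card_conicForm_eq_zero, card_univ, Fintype.card_fun, Fintype.card_fin] at h
  simp only [ne_eq]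
  lia

lemma two_mul_card_not_isSquare (hF : ringChar F ≠ 2) :
    2 * #{a : F | ¬IsSquare a} = Fintype.card F - 1 := by
  have hsum := quadraticChar_sum_zero hF
  have hpt : ∀ a : F, quadraticChar F a =
      1 - (if a = 0 then 1 else 0) - 2 * (if ¬IsSquare a then 1 else 0) := by
    intro a
    by_cases h0 : a = 0
    · simp [h0]
    · by_cases h : IsSquare a
      · rw [(quadraticChar_one_iff_isSquare h0).2 h]
        simp [h0, h]
      · rw [quadraticChar_neg_one_iff_not_isSquare.2 h]
        simp [h0, h]
  simp only [hpt, sum_sub_distrib, ← mul_sum] at hsum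
  rw [sum_ite_eq' univ (0 : F), sum_boole] at hsum
  simp only [sum_const, card_univ, mem_univ, if_true, nsmul_eq_mul, mul_one] at hsum
  lia

lemma card_not_isSquare_conicForm :
    #{s : Fin 3 → F | ¬IsSquare (conicForm s)} =
      #{a : F | ¬IsSquare a} * ((Fintype.card F - 1) * Fintype.card F) := by
  have : #{a : F | ¬IsSquare a} * ((Fintype.card F - 1) * Fintype.card F) =
      #(({a : F | ¬IsSquare a} : Finset F) ×ˢ (univ : Finset F).erase 0 ×ˢ (univ : Finset F)) := by
    rw [card_product, card_product, card_erase_of_mem (mem_univ _), card_univ]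
  rw [this]
  refine card_nbij' (fun s => (conicForm s, s 0, s 1))
    (fun a => ![a.2.1, a.2.2, (a.2.2 ^ 2 - a.1) / a.2.1]) ?_ ?_ ?_ ?_
  · intro s hs
    simp only [coe_filter, mem_univ, true_and, Set.mem_ofPred_eq] at hs
    have h0 : s 0 ≠ 0 := by
      intro h0
      exact hs ⟨s 1, by rw [conicForm, h0]; ring⟩
    simpa using ⟨hs, h0⟩
  · rintro ⟨a, x, y⟩ h
    simp only [coe_product, coe_filter, coe_erase, mem_univ, true_and, coe_univ, Set.mem_prod,
      Set.mem_ofPred_eq, Set.mem_sdiff, Set.mem_univ, Set.mem_singleton_iff, and_true] at h ⊢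
    have hval : conicForm ![x, y, (y ^ 2 - a) / x] = a := by
      simp [conicForm]
      field_simp [h.2]
      ring
    rw [hval]
    exact h.1
  · intro s hs
    simp only [coe_filter, mem_univ, true_and, Set.mem_ofPred_eq] at hs
    have h0 : s 0 ≠ 0 := by
      intro h0
      exact hs ⟨s 1, by rw [conicForm, h0]; ring⟩
    funext i
    fin_cases i <;> simp [conicForm, h0]
  · rintro ⟨a, x, y⟩ h
    simp only [coe_product, coe_filter, coe_erase, mem_univ, true_and, coe_univ, Set.mem_prod,
      Set.mem_ofPred_eq, Set.mem_sdiff, Set.mem_univ, Set.mem_singleton_iff, and_true] at h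
    have hx := h.2
    simp [conicForm]
    field_simp
    ring

lemma card_not_isSquare_conicForm_mul_two (hF : ringChar F ≠ 2) :
    #{s : Fin 3 → F | ¬IsSquare (conicForm s)} * 2 =
      Fintype.card F * (Fintype.card F - 1) ^ 2 := by
  rw [card_not_isSquare_conicForm, mul_comm, ← mul_assoc, two_mul_card_not_isSquare hF]
  ring

lemma card_isSquare_conicForm :
    #{s : Fin 3 → F | conicForm s ≠ 0 ∧ IsSquare (conicForm s)} =
      Fintype.card F ^ 3 - Fintype.card F ^ 2 - #{s : Fin 3 → F | ¬IsSquare (conicForm s)} := by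
  rw [← card_conicForm_ne_zero]
  have h := card_filter_add_card_filter_not
    (s := ({s | conicForm s ≠ 0} : Finset (Fin 3 → F))) (fun s => IsSquare (conicForm s))
  rw [filter_filter, filter_filter] at h
  have h' : #{s : Fin 3 → F | conicForm s ≠ 0 ∧ ¬IsSquare (conicForm s)} =
      #{s : Fin 3 → F | ¬IsSquare (conicForm s)} := by
    congr 1
    ext s
    simp only [mem_filter, mem_univ, true_and, and_iff_right_iff_imp]
    intro hs h0
    exact hs (h0 ▸ IsSquare.zero)
  lia

end

/-! ### Weights and weight distributions of the cosets -/

lemma exists_isConicMatrix_gdrsParityCheck {F : Type*} [Field F] [Fintype F] {q : ℕ}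
    (hq : Fintype.card F = q) {α : Fin (q - 1) → F} (hα0 : ∀ i, α i ≠ 0)
    (hα : Function.Injective α) {v : Fin (q + 1) → F} (hv : ∀ j, v j ≠ 0) :
    ∃ e : Fin (q + 1) ≃ Option F, IsConicMatrix (gdrsParityCheck q 4 α v) e v := by
  classical
  let f : Fin (q + 1) → Option F := fun j =>
    if h : (j : ℕ) < q - 1 then some (α ⟨j, h⟩) else if (j : ℕ) = q - 1 then some 0 else none
  have hf : Function.Injective f := by
    intro j k hjk
    have hj := j.2
    have hk := k.2
    apply Fin.ext
    by_cases h1 : (j : ℕ) < q - 1 <;> by_cases h2 : (k : ℕ) < q - 1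
    · simp only [f, h1, h2, dite_true, Option.some_inj] at hjk
      simpa using hα hjk
    · simp only [f, h1, h2, dite_true, dite_false] at hjk
      split_ifs at hjk with h3
      exact absurd (Option.some_injective _ hjk) (hα0 _)
    · simp only [f, h1, h2, dite_true, dite_false] at hjk
      split_ifs at hjk with h3
      exact absurd (Option.some_injective _ hjk).symm (hα0 _)
    · simp only [f, h1, h2, dite_false] at hjk
      split_ifs at hjk with h3 h4 h4 <;> lia
  have hbij : Function.Bijective f := by
    rw [Fintype.bijective_iff_injective_and_card]
    exact ⟨hf, by rw [Fintype.card_fin, Fintype.card_option, hq]⟩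
  refine ⟨Equiv.ofBijective f hbij, hv, fun i j => ?_⟩
  rw [gdrsParityCheck, Matrix.mul_diagonal, Matrix.of_apply, mul_comm]
  congr 1
  rw [Equiv.ofBijective_apply]
  by_cases h1 : (j : ℕ) < q - 1
  · simp only [f, h1, dite_true, conicPoint]
    fin_cases i <;> simp
  · by_cases h2 : (j : ℕ) = q - 1
    · simp only [f, h2, lt_irrefl, dite_false, if_true, conicPoint]
      fin_cases i <;> simp
    · simp only [f, h1, h2, dite_false, if_false, conicPoint]
      fin_cases i <;> simp

namespace IsConicMatrix

variable {F : Type*} [Field F] [DecidableEq F] {n : ℕ} {H : Matrix (Fin 3) (Fin n) F}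
  {e : Fin n ≃ Option F} {v : Fin n → F} (hH : IsConicMatrix H e v)

include hH

lemma exists_hammingNorm_le_three (hn : 3 ≤ n) (s : Fin 3 → F) :
    ∃ x, H.mulVec x = s ∧ hammingNorm x ≤ 3 := by
  obtain ⟨x, hx, -, hwt⟩ := exists_mulVec_eq_of_three_le_card
    (fun x => hH.eq_zero_of_mulVec_eq_zero hn) s (U := univ) (by simpa using hn)
  exact ⟨x, hx, hwt⟩

lemma mulVec_surjective (hn : 3 ≤ n) : Function.Surjective H.mulVec := fun s =>
  (hH.exists_hammingNorm_le_three hn s).imp fun _ h => h.1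

variable [Fintype F]

omit hH in
lemma weightCount_syndromeFiber_ne_zero {s : Fin 3 → F} {w : ℕ} :
    weightCount (syndromeFiber H s) w ≠ 0 ↔ ∃ x, H.mulVec x = s ∧ hammingNorm x = w := by
  rw [weightCount_syndromeFiber, card_ne_zero, filter_nonempty_iff]
  simp

lemma weightCount_eq_zero_of_lt_two {s : Fin 3 → F} (hs : conicForm s ≠ 0) {w : ℕ} (hw : w < 2) :
    weightCount (syndromeFiber H s) w = 0 := by
  by_contra h
  obtain ⟨x, hx, hxw⟩ := weightCount_syndromeFiber_ne_zero.1 h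
  have := hH.two_le_hammingNorm hs hx
  lia

lemma cosetWeight_eq_two_iff {s : Fin 3 → F} :
    cosetWeight (syndromeFiber H s) = 2 ↔
      conicForm s ≠ 0 ∧ weightCount (syndromeFiber H s) 2 ≠ 0 := by
  rw [weightCount_syndromeFiber_ne_zero]
  constructor
  · intro h
    constructor
    · intro h0
      obtain ⟨x, hx, hwt⟩ := hH.exists_hammingNorm_le_one h0
      have := (cosetWeight_le (V := syndromeFiber H s) hx).trans hwt
      lia
    · have hne : (syndromeFiber H s).Nonempty := by
        -- an empty set would have weight `sInf ∅ = 0`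
        by_contra hne
        rw [Set.not_nonempty_iff_eq_empty] at hne
        simp [cosetWeight, hne] at h
      obtain ⟨x, hx, hwt⟩ := exists_mem_hammingNorm_eq_cosetWeight hne
      exact ⟨x, hx, hwt.trans h⟩
  · rintro ⟨hs, x, hx, hwt⟩
    exact cosetWeight_eq hx hwt.le fun y hy => hH.two_le_hammingNorm hs hy

lemma cosetWeight_eq_three_iff (hn : 3 ≤ n) {s : Fin 3 → F} :
    cosetWeight (syndromeFiber H s) = 3 ↔
      conicForm s ≠ 0 ∧ weightCount (syndromeFiber H s) 2 = 0 := by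
  obtain ⟨x, hx, hwt⟩ := hH.exists_hammingNorm_le_three hn s
  constructor
  · intro h
    constructor
    · intro h0
      obtain ⟨x, hx, hwt⟩ := hH.exists_hammingNorm_le_one h0
      have := (cosetWeight_le (V := syndromeFiber H s) hx).trans hwt
      lia
    · by_contra h2
      obtain ⟨y, hy, hyw⟩ := weightCount_syndromeFiber_ne_zero.1 h2
      have := cosetWeight_le (V := syndromeFiber H s) hy
      lia
  · rintro ⟨hs, h2⟩
    refine cosetWeight_eq hx hwt fun y hy => ?_
    have hy2 := hH.two_le_hammingNorm hs hy
    have hne : hammingNorm y ≠ 2 := fun hyw =>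
      weightCount_syndromeFiber_ne_zero.2 ⟨y, hy, hyw⟩ h2
    lia

lemma weightCount_eq (hn : 3 ≤ n) {s : Fin 3 → F} (hs : conicForm s ≠ 0) {w : ℕ} (hw : 3 ≤ w) :
    (weightCount (syndromeFiber H s) w : ℤ) =
      weightCount (codeOfParityCheck H : Set (Fin n → F)) w
        - (-1) ^ w * (n.choose w : ℤ) * ((w - 1).choose 2 : ℤ)
        + (-1) ^ w * ((n - 2).choose (w - 2) : ℤ) * weightCount (syndromeFiber H s) 2 := by
  rw [coe_codeOfParityCheck]
  exact weightCount_syndromeFiber_eq (fun x => hH.eq_zero_of_mulVec_eq_zero hn) s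
    (fun x hx => hH.two_le_hammingNorm hs hx) hw

lemma hasDistributionDSubTwo (hn : 3 ≤ n) {s : Fin 3 → F} (hs : conicForm s ≠ 0) {b : ℕ}
    (hb : weightCount (syndromeFiber H s) 2 = b) :
    HasDistributionDSubTwo (codeOfParityCheck H) 4 (syndromeFiber H s) b := by
  refine ⟨fun w hw => hH.weightCount_eq_zero_of_lt_two hs hw, hb, fun w hw hwn => ?_⟩
  have h := hH.weightCount_eq hn hs hw
  have hsign : (-1 : ℤ) ^ (w + 4) = (-1) ^ w := by
    rw [pow_add]
    norm_num
  have hchoose : (n + 2 - 4).choose (n - w) = (n - 2).choose (w - 2) := by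
    rw [show n + 2 - 4 = n - 2 by lia]
    exact Nat.choose_symm_of_eq_add (by lia)
  rw [hb] at h
  rw [hsign, hchoose, Omega, Omega, hsign]
  simp only [Nat.sub_zero, Nat.sub_self, Nat.choose_zero_right, Nat.cast_one, mul_one,
    show 4 - 2 = 2 from rfl]
  exact ⟨h, h⟩

/-- Without codewords of weight three, the general formula at `w = 3` reads `binom n 3`. -/
lemma weightCount_three (hn : 3 ≤ n) {s : Fin 3 → F} (hs : conicForm s ≠ 0)
    (h2 : weightCount (syndromeFiber H s) 2 = 0) :
    weightCount (syndromeFiber H s) 3 = n.choose 3 := by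
  have h := hH.weightCount_eq hn hs (le_refl 3)
  have h0 : weightCount (codeOfParityCheck H : Set (Fin n → F)) 3 = 0 := by
    rw [coe_codeOfParityCheck]
    by_contra hne
    obtain ⟨x, hx, hxw⟩ := weightCount_syndromeFiber_ne_zero.1 hne
    rw [hH.eq_zero_of_mulVec_eq_zero hn hx hxw.le, hammingNorm_zero] at hxw
    lia
  rw [h0, h2] at h
  norm_num at h
  exact_mod_cast h

omit hH in
lemma ncard_cosetsOfWeight_and (hsurj : Function.Surjective H.mulVec) (w : ℕ)
    (P : Set (Fin n → F) → Prop) (Q : (Fin 3 → F) → Prop) [DecidablePred Q]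
    (hQ : ∀ s, cosetWeight (syndromeFiber H s) = w ∧ P (syndromeFiber H s) ↔ Q s) :
    {V | V ∈ cosetsOfWeight (codeOfParityCheck H) w ∧ P V}.ncard = #{s | Q s} := by
  simp only [cosetsOfWeight, Set.mem_ofPred_eq, and_assoc]
  rw [ncard_setOf_mem_cosets hsurj, ← Set.ncard_coe_finset]
  congr 1
  ext s
  simp [hQ]

omit [Fintype F] in
lemma exists_syndrome {V : Set (Fin n → F)} (hn : 3 ≤ n)
    (hV : V ∈ cosets (codeOfParityCheck H)) : ∃ s, V = syndromeFiber H s := by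
  rw [cosets_eq_range (hH.mulVec_surjective hn)] at hV
  obtain ⟨s, rfl⟩ := hV
  exact ⟨s, rfl⟩

lemma two_mul_weightCount_two_of_isSquare (hn : 3 ≤ n) (h2 : (2 : F) ≠ 0) {s : Fin 3 → F}
    (hs : conicForm s ≠ 0) (hsq : IsSquare (conicForm s)) :
    2 * weightCount (syndromeFiber H s) 2 = Fintype.card F - 1 := by
  rw [hH.two_mul_weightCount_two hn hs, card_conicPolar_ne_zero,
    card_conicPolar_eq_zero_of_isSquare h2 hs hsq]
  lia

lemma two_mul_weightCount_two_of_not_isSquare (hn : 3 ≤ n) {s : Fin 3 → F}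
    (hsq : ¬IsSquare (conicForm s)) :
    2 * weightCount (syndromeFiber H s) 2 = Fintype.card F + 1 := by
  rw [hH.two_mul_weightCount_two hn fun h => hsq (h ▸ IsSquare.zero), card_conicPolar_ne_zero,
    card_conicPolar_eq_zero_of_not_isSquare hsq, Nat.sub_zero]

lemma two_mul_weightCount_two_of_charP_two [CharP F 2] (hn : 3 ≤ n) {s : Fin 3 → F}
    (hs : conicForm s ≠ 0) (hnuc : ¬(s 0 = 0 ∧ s 2 = 0)) :
    2 * weightCount (syndromeFiber H s) 2 = Fintype.card F := by
  rw [hH.two_mul_weightCount_two hn hs, card_conicPolar_ne_zero,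
    card_conicPolar_eq_zero_of_charP_two hnuc]
  lia

lemma weightCount_two_of_nucleus [CharP F 2] (hn : 3 ≤ n) {s : Fin 3 → F}
    (hs : conicForm s ≠ 0) (hnuc : s 0 = 0 ∧ s 2 = 0) :
    weightCount (syndromeFiber H s) 2 = 0 := by
  have h := hH.two_mul_weightCount_two hn hs
  rw [card_conicPolar_ne_zero_of_nucleus hnuc] at h
  lia

/-- In odd characteristic every point off the conic lies on a secant. -/
lemma weightCount_two_ne_zero_of_odd (hn : 3 ≤ n) (hodd : Odd (Fintype.card F))
    (h2 : (2 : F) ≠ 0) {s : Fin 3 → F} (hs : conicForm s ≠ 0) :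
    weightCount (syndromeFiber H s) 2 ≠ 0 := by
  have hcard : 1 < Fintype.card F := Fintype.one_lt_card
  obtain ⟨k, hk⟩ := hodd
  by_cases hsq : IsSquare (conicForm s)
  · have := hH.two_mul_weightCount_two_of_isSquare hn h2 hs hsq
    lia
  · have := hH.two_mul_weightCount_two_of_not_isSquare hn hsq
    lia

lemma weightCount_two_eq_zero_iff [CharP F 2] (hn : 3 ≤ n) {s : Fin 3 → F}
    (hs : conicForm s ≠ 0) :
    weightCount (syndromeFiber H s) 2 = 0 ↔ s 0 = 0 ∧ s 2 = 0 := by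
  refine ⟨fun h => ?_, hH.weightCount_two_of_nucleus hn hs⟩
  by_contra hnuc
  have := hH.two_mul_weightCount_two_of_charP_two hn hs hnuc
  have := Fintype.card_pos (α := F)
  lia

end IsConicMatrix

lemma eq_nucleus_iff {F : Type*} [Field F] {s : Fin 3 → F} :
    (conicForm s ≠ 0 ∧ s 0 = 0 ∧ s 2 = 0) ↔ ∃ a : F, a ≠ 0 ∧ s = ![0, a, 0] := by
  constructor
  · rintro ⟨hs, h0, h2⟩
    refine ⟨s 1, fun h1 => hs (by simp [conicForm, h0, h1]), ?_⟩
    funext i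
    fin_cases i <;> simp [h0, h2]
  · rintro ⟨a, ha, rfl⟩
    simp [conicForm, ha]

lemma card_nucleus {F : Type*} [Field F] [Fintype F] [DecidableEq F] :
    #{s : Fin 3 → F | conicForm s ≠ 0 ∧ s 0 = 0 ∧ s 2 = 0} = Fintype.card F - 1 := by
  rw [← card_univ, ← card_erase_of_mem (mem_univ (0 : F))]
  refine card_nbij' (fun s => s 1) (fun a => ![0, a, 0]) ?_ ?_ ?_ ?_
  · intro s hs
    obtain ⟨a, ha, rfl⟩ := eq_nucleus_iff.1 (mem_filter.1 hs).2
    simpa using ha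
  · intro a ha
    have ha0 : a ≠ 0 := by simpa using ha
    rw [mem_coe, mem_filter]
    exact ⟨mem_univ _, eq_nucleus_iff.2 ⟨a, ha0, rfl⟩⟩
  · intro s hs
    obtain ⟨a, ha, rfl⟩ := eq_nucleus_iff.1 (mem_filter.1 hs).2
    simp
  · intro a _
    simp

lemma card_not_nucleus {F : Type*} [Field F] [Fintype F] [DecidableEq F] :
    #{s : Fin 3 → F | conicForm s ≠ 0 ∧ ¬(s 0 = 0 ∧ s 2 = 0)} =
      (Fintype.card F - 1) * (Fintype.card F ^ 2 - 1) := by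
  have h := card_filter_add_card_filter_not
    (s := ({s | conicForm s ≠ 0} : Finset (Fin 3 → F))) (fun s => s 0 = 0 ∧ s 2 = 0)
  rw [filter_filter, filter_filter, card_conicForm_ne_zero, card_nucleus] at h
  obtain ⟨k, hk⟩ : ∃ k, Fintype.card F = k + 1 := ⟨Fintype.card F - 1, by
    have := Fintype.card_pos (α := F)
    lia⟩
  rw [hk] at h ⊢
  have h1 : (k + 1) ^ 3 - (k + 1) ^ 2 = k * (k + 1) ^ 2 := by
    rw [pow_succ _ 2, mul_comm, ← Nat.sub_one_mul, Nat.add_sub_cancel]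
  rw [h1, Nat.add_sub_cancel] at h
  rw [Nat.add_sub_cancel, Nat.mul_sub, mul_one]
  lia

end MDSCoset

open MDSCoset in
theorem mainTheorem9 {F : Type*} [Field F] [Fintype F] [DecidableEq F]
    (q : ℕ) (hq : Fintype.card F = q)
    (α : Fin (q - 1) → F) (hα0 : ∀ i, α i ≠ 0) (hα : Function.Injective α)
    (v : Fin (q + 1) → F) (hv : ∀ j, v j ≠ 0)
    (H : Matrix (Fin 3) (Fin (q + 1)) F) (hH : H = MDSCoset.gdrsParityCheck q 4 α v)
    (C : Submodule F (Fin (q + 1) → F)) (hC : C = MDSCoset.codeOfParityCheck H) :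
    -- the parameters of the code; for `q = 2` it is the zero code
    (Module.finrank F C = q - 2 ∧ (3 ≤ q → IsLeast (MDSCoset.nonzeroWeights C) 4)) ∧
    (Odd q →
      MDSCoset.coveringRadius C = 2 ∧
      {V | V ∈ MDSCoset.cosetsOfWeight C 2 ∧
        MDSCoset.weightCount V 2 = (q + 1) / 2}.ncard = q * (q - 1) ^ 2 / 2 ∧
      {V | V ∈ MDSCoset.cosetsOfWeight C 2 ∧
        MDSCoset.weightCount V 2 = (q - 1) / 2}.ncard = (q ^ 3 - q) / 2 ∧
      ∀ V ∈ MDSCoset.cosetsOfWeight C 2,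
        MDSCoset.HasDistributionDSubTwo C 4 V ((q + 1) / 2) ∨
        MDSCoset.HasDistributionDSubTwo C 4 V ((q - 1) / 2)) ∧
    (Even q →
      MDSCoset.coveringRadius C = 3 ∧
      (MDSCoset.cosetsOfWeight C 2).ncard = (q - 1) * (q ^ 2 - 1) ∧
      (∀ V ∈ MDSCoset.cosetsOfWeight C 2, MDSCoset.HasDistributionDSubTwo C 4 V (q / 2)) ∧
      (MDSCoset.cosetsOfWeight C 3).ncard = q - 1 ∧
      -- the weight 3 cosets are those whose syndrome is a representative of the nucleus
      (∀ V ∈ MDSCoset.cosets C, V ∈ MDSCoset.cosetsOfWeight C 3 ↔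
        ∃ a : F, a ≠ 0 ∧ ∀ x ∈ V, H.mulVec x = ![0, a, 0]) ∧
      ∀ V ∈ MDSCoset.cosetsOfWeight C 3,
        (∀ w, w ≤ 2 → MDSCoset.weightCount V w = 0) ∧
        MDSCoset.weightCount V 3 = (q + 1).choose 3 ∧
        ∀ w, 4 ≤ w → w ≤ q + 1 →
          (MDSCoset.weightCount V w : ℤ) =
            MDSCoset.weightCount (C : Set (Fin (q + 1) → F)) w
              - (-1) ^ w * ((q + 1).choose w : ℤ) * ((w - 1).choose 2 : ℤ)) := by
  obtain ⟨e, hM⟩ := exists_isConicMatrix_gdrsParityCheck hq hα0 hα hv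
  replace hM : IsConicMatrix H e v := hH ▸ hM
  subst hC
  have hq2 : 1 < q := hq ▸ Fintype.one_lt_card
  have hn : 3 ≤ q + 1 := by lia
  have hsurj := hM.mulVec_surjective hn
  have hmin : ∀ x : Fin (q + 1) → F, H.mulVec x = 0 → hammingNorm x ≤ 3 → x = 0 :=
    fun x => hM.eq_zero_of_mulVec_eq_zero hn
  have hform : conicForm (![0, 1, 0] : Fin 3 → F) ≠ 0 := by simp [conicForm]
  refine ⟨⟨?_, fun hq3 => isLeast_nonzeroWeights hmin (by lia)⟩, fun hodd => ?_, fun heven => ?_⟩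
  · rw [finrank_codeOfParityCheck hsurj]
    lia
  · have hchar : ringChar F ≠ 2 := by
      intro h
      have := FiniteField.even_card_iff_char_two.1 h
      rw [hq] at this
      obtain ⟨k, hk⟩ := hodd
      lia
    have h2 : (2 : F) ≠ 0 := Ring.two_ne_zero hchar
    have hwt : ∀ s, cosetWeight (syndromeFiber H s) = 2 ↔ conicForm s ≠ 0 := by
      intro s
      rw [hM.cosetWeight_eq_two_iff]
      exact and_iff_left_of_imp fun hs => hM.weightCount_two_ne_zero_of_odd hn (hq ▸ hodd) h2 hs
    have hsq := fun {s} hs hs' => hM.two_mul_weightCount_two_of_isSquare hn h2 (s := s) hs hs'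
    have hnsq := fun {s} hs => hM.two_mul_weightCount_two_of_not_isSquare hn (s := s) hs
    simp only [hq] at hsq hnsq
    have hcount := card_not_isSquare_conicForm_mul_two hchar
    rw [hq] at hcount
    refine ⟨?_, ?_, ?_, ?_⟩
    · refine coveringRadius_eq (s₀ := ![0, 1, 0]) (fun s => ?_)
        (fun x hx => hM.two_le_hammingNorm hform hx)
      by_cases hs : conicForm s = 0
      · obtain ⟨x, hx, hxw⟩ := hM.exists_hammingNorm_le_one hs
        exact ⟨x, hx, by lia⟩
      · obtain ⟨x, hx, hxw⟩ := IsConicMatrix.weightCount_syndromeFiber_ne_zero.1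
          (hM.weightCount_two_ne_zero_of_odd hn (hq ▸ hodd) h2 hs)
        exact ⟨x, hx, hxw.le⟩
    · rw [IsConicMatrix.ncard_cosetsOfWeight_and hsurj 2 _ (fun s => ¬IsSquare (conicForm s))]
      · lia
      · intro s
        rw [hwt]
        constructor
        · rintro ⟨hs, hb⟩ hs'
          have := hsq hs hs'
          lia
        · intro hs
          have := hnsq hs
          exact ⟨fun h => hs (h ▸ IsSquare.zero), by lia⟩
    · rw [IsConicMatrix.ncard_cosetsOfWeight_and hsurj 2 _
        (fun s => conicForm s ≠ 0 ∧ IsSquare (conicForm s)), card_isSquare_conicForm, hq]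
      · obtain ⟨k, hk⟩ := hodd
        rw [hk, Nat.add_sub_cancel] at hcount
        rw [hk]
        have h3 : (2 * k + 1) ^ 3 = 8 * k ^ 3 + 12 * k ^ 2 + 6 * k + 1 := by ring
        have h4 : (2 * k + 1) ^ 2 = 4 * k ^ 2 + 4 * k + 1 := by ring
        have h5 : (2 * k + 1) * (2 * k) ^ 2 = 8 * k ^ 3 + 4 * k ^ 2 := by ring
        lia
      · intro s
        rw [hwt]
        refine and_congr_right fun hs => ⟨fun hb => ?_, fun hs' => ?_⟩
        · by_contra hs'
          have := hnsq hs'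
          lia
        · have := hsq hs hs'
          lia
    · rintro V ⟨hV, hV2⟩
      obtain ⟨s, rfl⟩ := hM.exists_syndrome hn hV
      have hs := (hwt s).1 hV2
      by_cases hs' : IsSquare (conicForm s)
      · right
        have := hsq hs hs'
        exact hM.hasDistributionDSubTwo hn hs (by lia)
      · left
        have := hnsq hs'
        exact hM.hasDistributionDSubTwo hn hs (by lia)
  · have hchar : CharP F 2 := by
      refine ringChar.of_eq (FiniteField.even_card_iff_char_two.2 ?_)
      rw [hq]
      exact Nat.even_iff.1 heven
    have hwt2 : ∀ s, cosetWeight (syndromeFiber H s) = 2 ↔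
        conicForm s ≠ 0 ∧ ¬(s 0 = 0 ∧ s 2 = 0) := by
      intro s
      rw [hM.cosetWeight_eq_two_iff]
      exact and_congr_right fun hs => not_congr (hM.weightCount_two_eq_zero_iff hn hs)
    have hwt3 : ∀ s, cosetWeight (syndromeFiber H s) = 3 ↔
        conicForm s ≠ 0 ∧ s 0 = 0 ∧ s 2 = 0 := by
      intro s
      rw [hM.cosetWeight_eq_three_iff hn]
      exact and_congr_right fun hs => hM.weightCount_two_eq_zero_iff hn hs
    refine ⟨?_, ?_, ?_, ?_, ?_, ?_⟩
    · refine coveringRadius_eq (s₀ := ![0, 1, 0]) (hM.exists_hammingNorm_le_three hn)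
        (fun x hx => ?_)
      rw [← (hwt3 ![0, 1, 0]).2 ⟨hform, by simp, by simp⟩]
      exact cosetWeight_le hx
    · have := IsConicMatrix.ncard_cosetsOfWeight_and hsurj 2 (fun _ => True) _
        (fun s => (and_iff_left trivial).trans (hwt2 s))
      rw [card_not_nucleus, hq] at this
      simpa using this
    · rintro V ⟨hV, hV2⟩
      obtain ⟨s, rfl⟩ := hM.exists_syndrome hn hV
      obtain ⟨hs, hnuc⟩ := (hwt2 s).1 hV2
      have := hM.two_mul_weightCount_two_of_charP_two hn hs hnuc
      rw [hq] at this
      exact hM.hasDistributionDSubTwo hn hs (by lia)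
    · have := IsConicMatrix.ncard_cosetsOfWeight_and hsurj 3 (fun _ => True) _
        (fun s => (and_iff_left trivial).trans (hwt3 s))
      rw [card_nucleus, hq] at this
      simpa using this
    · intro V hV
      obtain ⟨s, rfl⟩ := hM.exists_syndrome hn hV
      have : syndromeFiber H s ∈ cosetsOfWeight (codeOfParityCheck H) 3 ↔
          cosetWeight (syndromeFiber H s) = 3 := and_iff_right hV
      rw [this, hwt3, eq_nucleus_iff]
      refine exists_congr fun a => and_congr_right fun _ => ⟨?_, fun h => ?_⟩
      · rintro rfl x hx
        exact hx
      · obtain ⟨x, rfl⟩ := hsurj s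
        exact h x rfl
    · rintro V ⟨hV, hV3⟩
      obtain ⟨s, rfl⟩ := hM.exists_syndrome hn hV
      obtain ⟨hs, h2⟩ := (hM.cosetWeight_eq_three_iff hn).1 hV3
      refine ⟨fun w hw => ?_, hM.weightCount_three hn hs h2, fun w hw _ => ?_⟩
      · rcases hw.lt_or_eq with hw | rfl
        · exact hM.weightCount_eq_zero_of_lt_two hs hw
        · exact h2
      · rw [hM.weightCount_eq hn hs (by lia), h2]
        simp
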